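/- Let $d\ge 1$ and $A=\{\pm e_1,\dots,\pm e_d\}\subset\mathbb Z^d$. For $i=1,2$ let $(\Omega_i,\mathcal F_i,\mathbb P_i)$ be a probability space with an ergodic action $(V^{(i)}_z)_{z\in\mathbb Z^d}$ of $\mathbb Z^d$ by measure-preserving maps, and let $\tau_i:\mathbb Z^d\times A\times\Omega_i\to\mathbb R$ be measurable in $\omega$ and stationary, i.e. $\tau_i(x+z,\alpha,\omega)=\tau_i(x,\alpha,V^{(i)}_z\omega)$; $\tau_i(x,\alpha,\omega)$ is the weight of the directed edge from $x$ to $x+\alpha$. Assume $$0<a_i=\operatorname*{ess\,inf}_{x,\alpha,\omega}\tau_i(x,\alpha,\omega),\qquad b_i=\operatorname*{ess\,sup}_{x,\alpha,\omega}\tau_i(x,\alpha,\omega)<\infty .$$ Let $\mathcal T_i(x)$ be the first-passage time from $x\in\mathbb Z^d$ to $0$, i.e. the infimum of the total weights of the nearest-neighbour paths from $x$ to $0$, and let the time-constant $m_i$ be the deterministic function given by $m_i(x)=\lim_{n\to\infty}\mathcal T_i([nx])/n$ almost surely, for each $x\in\mathbb R^d$, where $[y]$ is the lattice point closest to $y$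 (coordinatewise rounding, ties rounded up). Let $P_i$ be the law of the weight configuration $(\tau_i(x,\alpha))_{x\in\mathbb Z^d,\alpha\in A}$ on $\mathbb R^{\mathbb Z^d\times A}$ with the product $\sigma$-algebra, and let $$d(P_1,P_2)=\inf_{\pi}\ \operatorname*{ess\,sup}_{(t_1,t_2)\sim\pi}\ \sup_{x\in\mathbb Z^d,\ \alpha\in A}|t_1(x,\alpha)-t_2(x,\alpha)| ,$$ where $\pi$ ranges over all couplings of $P_1$ and $P_2$ (the $W^\infty$ Wasserstein distance for the supremum distance of configurations). Then the time-constants $m_1,m_2$ exist, and for all $x\in\mathbb R^d$ $$|m_1(x)-m_2(x)|\le\max\left(\frac{b_1}{a_1},\frac{b_2}{a_2}\right)d(P_1,P_2)\,|x|_1,\qquad |x|_1=\sum_{j=1}^d|x_j| .$$ -/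

import Mathlib

open MeasureTheory Filter
open scoped Topology ENNReal

namespace FPP

/-- The control directions `A = {±e₁, …, ±e_d}` of the lattice `ℤ^d`. -/
def directions (d : ℕ) : Set (Fin d → ℤ) :=
  {α | ∃ i, α = Pi.single i 1 ∨ α = -Pi.single i 1}

/-- A configuration of edge weights: `t x α` is the weight of the directed edge from `x` to
`x + α`. Configurations carry the product `σ`-algebra. -/
abbrev Config (d : ℕ) : Type := (Fin d → ℤ) → directions d → ℝ

/-- A nearest-neighbour path is given by its starting point and the list of its successive steps
`α₁, …, αₙ ∈ A`; its vertices are `x, x + α₁, x + α₁ + α₂, …`. This is its last vertex. -/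
def pathEnd {d : ℕ} : (Fin d → ℤ) → List (directions d) → (Fin d → ℤ)
  | x, [] => x
  | x, α :: l => pathEnd (x + α) l

/-- The total weight of the edges traversed by the path with starting point `x` and steps `l`. -/
def pathWeight {d : ℕ} (t : Config d) : (Fin d → ℤ) → List (directions d) → ℝ
  | _, [] => 0
  | x, α :: l => t x α + pathWeight t (x + α) l

/-- The first-passage time from `x` to `y`: the infimum of the weights of the paths
from `x` to `y`. -/
noncomputable def passageTime {d : ℕ} (t : Config d) (x y : Fin d → ℤ) : ℝ :=
  sInf {w | ∃ l : List (directions d), pathEnd x l = y ∧ w = pathWeight t x l}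

/-- The lattice point `[x]` closest to `x` (ties are broken by rounding up). -/
noncomputable def nearestPoint {d : ℕ} (x : Fin d → ℝ) : Fin d → ℤ := fun i => round (x i)

/-- The scaled first-passage time `T([n x], 0) / n`. -/
noncomputable def scaledPassageTime {d : ℕ} (t : Config d) (n : ℕ) (x : Fin d → ℝ) : ℝ :=
  passageTime t (nearestPoint fun i => n * x i) 0 / n

variable {d : ℕ} {Ω : Type*}

/-- The configuration of the weights `τ` seen at the sample point `ω`. -/
def sample (τ : (Fin d → ℤ) → directions d → Ω → ℝ) (ω : Ω) : Config d :=
  fun x α => τ x α ω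

/-- The weights are random variables and `τ(x + z, α, ω) = τ(x, α, V_z ω)` for the action `V` of
`ℤ^d` on `Ω`. -/
structure IsStationary [MeasurableSpace Ω] [VAdd (Fin d → ℤ) Ω]
    (τ : (Fin d → ℤ) → directions d → Ω → ℝ) : Prop where
  measurable : ∀ x α, Measurable (τ x α)
  stationary : ∀ x z α ω, τ (x + z) α ω = τ x α (z +ᵥ ω)

/-- `0 < a < ∞` is the essential infimum and `b < ∞` the essential supremum of `τ(x, α, ω)` over
`x`, `α` and `ω`. -/
structure HasEssBounds [MeasurableSpace Ω] (P : Measure Ω)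
    (τ : (Fin d → ℤ) → directions d → Ω → ℝ) (a b : ℝ) : Prop where
  pos : 0 < a
  essInf : IsGreatest {c : ℝ | ∀ x α, ∀ᵐ ω ∂P, c ≤ τ x α ω} a
  essSup : IsLeast {c : ℝ | ∀ x α, ∀ᵐ ω ∂P, τ x α ω ≤ c} b

/-- `m` is the time-constant: `T([n x], 0) / n → m x` almost surely, for every `x ∈ ℝ^d`. -/
def IsTimeConstant [MeasurableSpace Ω] (P : Measure Ω)
    (τ : (Fin d → ℤ) → directions d → Ω → ℝ) (m : (Fin d → ℝ) → ℝ) : Prop :=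
  ∀ x, ∀ᵐ ω ∂P, Tendsto (fun n : ℕ => scaledPassageTime (sample τ ω) n x) atTop (𝓝 (m x))

/-- The law of the whole weight configuration, a measure on `Config d`. -/
noncomputable def law [MeasurableSpace Ω] (P : Measure Ω)
    (τ : (Fin d → ℤ) → directions d → Ω → ℝ) : Measure (Config d) :=
  P.map (sample τ)

/-- The couplings of two measures. -/
def couplings {X : Type*} [MeasurableSpace X] (P Q : Measure X) : Set (Measure (X × X)) :=
  {π | π.map Prod.fst = P ∧ π.map Prod.snd = Q}

/-- The `W^∞` Wasserstein distance between two laws of weight configurations, with respect to the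
supremum distance of configurations: the infimum over all couplings of the essential supremum of
`sup_{x, α} |t₁(x, α) - t₂(x, α)|`. -/
noncomputable def couplingDist (P Q : Measure (Config d)) : ℝ≥0∞ :=
  ⨅ π ∈ couplings P Q, essSup (fun t : Config d × Config d => ⨆ x, ⨆ α,
    edist (t.1 x α) (t.2 x α)) π

end FPP

/-! Comparison. If two configurations differ by at most `δ` everywhere, a near-optimal path for `t'`
has weight about `T'`, which is at most `b` times the `ℓ¹` distance. Its edges weigh at least `a`,
so its length is at most about `b / a` times that distance, and switching to `t` along it costs at
most `δ` per edge (`passageTime_le_add`). Dividing by `n` gives the bound for the limits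
(`le_of_tendsto_scaledPassageTime`). Since the time-constants are deterministic, one pair of
configurations from a coupling with essential supremum below `δ` suffices, provided it avoids a null
set. Only the marginals of the coupling matter for the two limits, so it need not be stationary.

Existence. Along a lattice direction `p` the passage times are subadditive for the shift by `p`, and
Kingman's theorem applies (`ae_exists_tendsto_of_subadditive`). Its proof covers orbits by good
blocks to get `∫ limsup ≤ ∫ liminf`. The passage time is Lipschitz in its endpoints, which extends
convergence to real directions by rational approximation. A single shift need not be ergodic; the
limit is constant because it is invariant under all of `ℤ^d`. -/

namespace FPP

/-! ### Paths and passage times for a fixed configuration -/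

section Deterministic

variable {d : ℕ}

/-- The `ℓ¹` distance of two lattice points. -/
noncomputable def latticeDist (x y : Fin d → ℤ) : ℝ := ∑ i, |(x i : ℝ) - y i|

lemma latticeDist_nonneg (x y : Fin d → ℤ) : 0 ≤ latticeDist x y :=
  Finset.sum_nonneg fun _ _ => abs_nonneg _

lemma latticeDist_comm (x y : Fin d → ℤ) : latticeDist x y = latticeDist y x := by
  simp only [latticeDist, abs_sub_comm]

lemma latticeDist_add_right (x y z : Fin d → ℤ) :
    latticeDist (x + z) (y + z) = latticeDist x y := by
  simp [latticeDist]

lemma pathEnd_append (x : Fin d → ℤ) (l l' : List (directions d)) :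
    pathEnd x (l ++ l') = pathEnd (pathEnd x l) l' := by
  induction l generalizing x with
  | nil => rfl
  | cons α l ih => exact ih _

lemma pathWeight_append (t : Config d) (x : Fin d → ℤ) (l l' : List (directions d)) :
    pathWeight t x (l ++ l') = pathWeight t x l + pathWeight t (pathEnd x l) l' := by
  induction l generalizing x with
  | nil => simp [pathWeight, pathEnd]
  | cons α l ih => simp [pathWeight, pathEnd, ih, add_assoc]

/-- Induction on the distance: one step towards `y` in a coordinate where the points differ lowers
it by one. -/
lemma exists_path (x y : Fin d → ℤ) :
    ∃ l : List (directions d), pathEnd x l = y ∧ (l.length : ℝ) = latticeDist x y := by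
  suffices h : ∀ (n : ℕ) (x y : Fin d → ℤ), ∑ i, (x i - y i).natAbs = n →
      ∃ l : List (directions d), pathEnd x l = y ∧ l.length = n by
    obtain ⟨l, h1, h2⟩ := h _ x y rfl
    refine ⟨l, h1, ?_⟩
    rw [h2, latticeDist]
    push_cast
    simp [Nat.cast_natAbs]
  intro n
  induction n with
  | zero =>
    intro x y h
    refine ⟨[], ?_, rfl⟩
    ext i
    have := (Finset.sum_eq_zero_iff.1 h) i (Finset.mem_univ i)
    simp only [pathEnd]
    omega
  | succ n ih =>
    intro x y h
    obtain ⟨i, hi⟩ : ∃ i, (x i - y i).natAbs ≠ 0 := by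
      by_contra! hc
      simp [hc] at h
    obtain ⟨α, hα, s, hs, hsi⟩ : ∃ α ∈ directions d, ∃ s : ℤ, α = Pi.single i s ∧
        (x i + s - y i).natAbs + 1 = (x i - y i).natAbs := by
      rcases lt_or_gt_of_ne (show x i ≠ y i by omega) with hlt | hgt
      · exact ⟨_, ⟨i, Or.inl rfl⟩, 1, rfl, by omega⟩
      · exact ⟨_, ⟨i, Or.inr rfl⟩, -1, by rw [Pi.single_neg], by omega⟩
    obtain ⟨l, h1, h2⟩ := ih (x + α) y (by
      rw [← Finset.add_sum_erase _ _ (Finset.mem_univ i)] at h ⊢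
      have : ∑ j ∈ Finset.univ.erase i, ((x + α) j - y j).natAbs
          = ∑ j ∈ Finset.univ.erase i, (x j - y j).natAbs := by
        refine Finset.sum_congr rfl fun j hj => ?_
        simp [hs, Pi.single_eq_of_ne (Finset.ne_of_mem_erase hj)]
      rw [this]
      simp only [hs, Pi.add_apply, Pi.single_eq_same]
      omega)
    exact ⟨⟨α, hα⟩ :: l, h1, by simp [h2]⟩

lemma pathWeight_le {t : Config d} {b : ℝ} (h : ∀ x α, t x α ≤ b) (x : Fin d → ℤ)
    (l : List (directions d)) : pathWeight t x l ≤ b * l.length := by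
  induction l generalizing x with
  | nil => simp [pathWeight]
  | cons α l ih =>
    have := ih (x + α)
    have := h x α
    simp only [pathWeight, List.length_cons]
    push_cast
    linarith

lemma le_pathWeight {t : Config d} {a : ℝ} (h : ∀ x α, a ≤ t x α) (x : Fin d → ℤ)
    (l : List (directions d)) : a * l.length ≤ pathWeight t x l := by
  induction l generalizing x with
  | nil => simp [pathWeight]
  | cons α l ih =>
    have := ih (x + α)
    have := h x α
    simp only [pathWeight, List.length_cons]
    push_cast
    linarith

lemma pathWeight_le_add {t t' : Config d} {δ : ℝ} (h : ∀ x α, t x α ≤ t' x α + δ)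
    (x : Fin d → ℤ) (l : List (directions d)) :
    pathWeight t x l ≤ pathWeight t' x l + δ * l.length := by
  induction l generalizing x with
  | nil => simp [pathWeight]
  | cons α l ih =>
    have := ih (x + α)
    have := h x α
    simp only [pathWeight, List.length_cons]
    push_cast
    linarith

lemma passageTime_le_pathWeight {t : Config d} (h : ∀ x α, 0 ≤ t x α) {x y : Fin d → ℤ}
    {l : List (directions d)} (hl : pathEnd x l = y) : passageTime t x y ≤ pathWeight t x l := by
  refine csInf_le ⟨0, ?_⟩ ⟨l, hl, rfl⟩
  rintro w ⟨l, -, rfl⟩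
  simpa using le_pathWeight h x l

lemma passageTime_nonneg {t : Config d} (h : ∀ x α, 0 ≤ t x α) (x y : Fin d → ℤ) :
    0 ≤ passageTime t x y := by
  refine Real.sInf_nonneg ?_
  rintro w ⟨l, -, rfl⟩
  simpa using le_pathWeight h x l

lemma exists_pathWeight_lt (t : Config d) (x y : Fin d → ℤ) {ε : ℝ} (hε : 0 < ε) :
    ∃ l, pathEnd x l = y ∧ pathWeight t x l < passageTime t x y + ε := by
  obtain ⟨l₀, hl₀, -⟩ := exists_path x y
  obtain ⟨w, ⟨l, hl, rfl⟩, hw⟩ := exists_lt_of_csInf_lt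
    (s := {w | ∃ l : List (directions d), pathEnd x l = y ∧ w = pathWeight t x l})
    ⟨_, l₀, hl₀, rfl⟩ (lt_add_of_pos_right _ hε)
  exact ⟨l, hl, hw⟩

lemma passageTime_le_latticeDist {t : Config d} {b : ℝ} (h : ∀ x α, 0 ≤ t x α)
    (hb : ∀ x α, t x α ≤ b) (x y : Fin d → ℤ) : passageTime t x y ≤ b * latticeDist x y := by
  obtain ⟨l, hl, hlen⟩ := exists_path x y
  exact hlen ▸ (passageTime_le_pathWeight h hl).trans (pathWeight_le hb x l)

lemma passageTime_triangle {t : Config d} (h : ∀ x α, 0 ≤ t x α) (x y z : Fin d → ℤ) :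
    passageTime t x z ≤ passageTime t x y + passageTime t y z := by
  refine le_of_forall_pos_le_add fun ε hε => ?_
  obtain ⟨l, hl, hw⟩ := exists_pathWeight_lt t x y (half_pos hε)
  obtain ⟨l', hl', hw'⟩ := exists_pathWeight_lt t y z (half_pos hε)
  have := passageTime_le_pathWeight h (x := x) (y := z) (l := l ++ l')
    (by rw [pathEnd_append, hl, hl'])
  rw [pathWeight_append, hl] at this
  linarith

lemma abs_passageTime_sub_le {t : Config d} {b : ℝ} (h : ∀ x α, 0 ≤ t x α)
    (hb : ∀ x α, t x α ≤ b) (x y x' y' : Fin d → ℤ) :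
    |passageTime t x y - passageTime t x' y'| ≤ b * (latticeDist x x' + latticeDist y y') := by
  have h1 := passageTime_triangle h x x' y
  have h2 := passageTime_triangle h x' y' y
  have h3 := passageTime_triangle h x' x y'
  have h4 := passageTime_triangle h x y y'
  have k1 := passageTime_le_latticeDist h hb x x'
  have k2 := passageTime_le_latticeDist h hb y' y
  have k3 := passageTime_le_latticeDist h hb x' x
  have k4 := passageTime_le_latticeDist h hb y y'
  rw [latticeDist_comm] at k2 k3
  rw [abs_le]
  constructor <;> linarith

/-- Near-optimal paths for `t'` are short, so changing every weight by at most `δ` changes the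
passage time by at most `δ` times their length. -/
lemma passageTime_le_add {t t' : Config d} {a b δ : ℝ} (ha : 0 < a) (hδ : 0 ≤ δ)
    (h : ∀ x α, 0 ≤ t x α) (ha' : ∀ x α, a ≤ t' x α) (hb' : ∀ x α, t' x α ≤ b)
    (htt' : ∀ x α, t x α ≤ t' x α + δ) (x y : Fin d → ℤ) :
    passageTime t x y ≤ passageTime t' x y + b / a * δ * latticeDist x y := by
  refine le_of_forall_pos_le_add fun ε hε => ?_
  obtain ⟨η, hη, hηε⟩ : ∃ η > 0, η + δ * (η / a) ≤ ε := by
    -- This `η` solves `η + δ * η / a = ε`: it pays for the path's excess weight and for the extra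
    -- edges this excess allows.
    refine ⟨ε / (1 + δ / a), by positivity, le_of_eq ?_⟩
    have : 1 + δ / a ≠ 0 := by positivity
    field_simp
  obtain ⟨l, hl, hw⟩ := exists_pathWeight_lt t' x y hη
  have h1 := passageTime_le_pathWeight h hl
  have h2 := pathWeight_le_add htt' x l
  have h3 := le_pathWeight ha' x l
  have h4 := passageTime_le_latticeDist (fun x α => ha.le.trans (ha' x α)) hb' x y
  have h5 : (l.length : ℝ) ≤ (b * latticeDist x y + η) / a := by
    rw [le_div_iff₀ ha]
    linarith
  have h6 : δ * l.length ≤ δ * ((b * latticeDist x y + η) / a) :=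
    mul_le_mul_of_nonneg_left h5 hδ
  have h7 : δ * ((b * latticeDist x y + η) / a)
      = b / a * δ * latticeDist x y + δ * (η / a) := by ring
  linarith

lemma pathEnd_add (x z : Fin d → ℤ) (l : List (directions d)) :
    pathEnd (x + z) l = pathEnd x l + z := by
  induction l generalizing x with
  | nil => rfl
  | cons α l ih => simp only [pathEnd, ← ih, add_right_comm]

lemma pathWeight_shift (t : Config d) (x z : Fin d → ℤ) (l : List (directions d)) :
    pathWeight (fun y => t (y + z)) x l = pathWeight t (x + z) l := by
  induction l generalizing x with
  | nil => rfl
  | cons α l ih => simp only [pathWeight, ih, add_right_comm]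

lemma passageTime_shift (t : Config d) (x y z : Fin d → ℤ) :
    passageTime (fun y => t (y + z)) x y = passageTime t (x + z) (y + z) := by
  simp only [passageTime, pathWeight_shift, pathEnd_add, add_left_inj]

lemma measurable_pathWeight (x : Fin d → ℤ) (l : List (directions d)) :
    Measurable fun t : Config d => pathWeight t x l := by
  induction l generalizing x with
  | nil => exact measurable_const
  | cons α l ih => exact Measurable.add (by fun_prop) (ih _)

/-- There are only countably many finite step lists, so this is a countable infimum. -/
lemma measurable_passageTime (x y : Fin d → ℤ) :
    Measurable fun t : Config d => passageTime t x y := by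
  have : ∀ t : Config d, passageTime t x y =
      sInf ((fun l => pathWeight t x l) '' {l : List (directions d) | pathEnd x l = y}) := by
    intro t
    rw [passageTime]
    congr 1
    ext w
    simp [eq_comm]
  simp only [this]
  exact Measurable.sInf (Set.to_countable _) fun l _ => measurable_pathWeight x l

lemma measurable_scaledPassageTime (n : ℕ) (x : Fin d → ℝ) :
    Measurable fun t : Config d => scaledPassageTime t n x :=
  (measurable_passageTime _ _).div_const _

lemma latticeDist_nearestPoint_le (x : Fin d → ℝ) (y : Fin d → ℤ) :
    latticeDist (nearestPoint x) y ≤ ∑ i, |x i - y i| + d := by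
  have : ∀ i, |((nearestPoint x i : ℤ) : ℝ) - y i| ≤ |x i - y i| + 1 := fun i => by
    have h1 := abs_sub_round (x i)
    have h2 := abs_sub_le ((round (x i) : ℤ) : ℝ) (x i) (y i)
    rw [abs_sub_comm] at h1
    simp only [nearestPoint]
    linarith
  calc latticeDist (nearestPoint x) y ≤ ∑ i, (|x i - y i| + 1) :=
        Finset.sum_le_sum fun i _ => this i
    _ = _ := by simp [Finset.sum_add_distrib]

lemma latticeDist_nearestPoint_zero_le (n : ℕ) (x : Fin d → ℝ) :
    latticeDist (nearestPoint fun i => n * x i) 0 ≤ n * ∑ i, |x i| + d := by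
  refine (latticeDist_nearestPoint_le _ _).trans (le_of_eq ?_)
  simp [abs_mul, Finset.mul_sum]

end Deterministic

/-! ### Kingman's subadditive ergodic theorem for bounded processes -/

section Kingman

/-- The quotients differ by at most `K / n`. This makes the upper and lower limits exactly
shift-invariant although the process is so only up to a bounded error. -/
lemma limsup_div_eq_of_bounded_sub {u v : ℕ → ℝ} {C K : ℝ} (hu : ∀ n : ℕ, |u n / n| ≤ C)
    (hv : ∀ n : ℕ, |v n / n| ≤ C) (huv : ∀ n, |u n - v n| ≤ K) :
    limsup (fun n : ℕ => u n / n) atTop = limsup (fun n : ℕ => v n / n) atTop ∧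
    liminf (fun n : ℕ => u n / n) atTop = liminf (fun n : ℕ => v n / n) atTop := by
  have key : ∀ {u v : ℕ → ℝ}, (∀ n : ℕ, |u n / n| ≤ C) → (∀ n : ℕ, |v n / n| ≤ C) →
      (∀ n, |u n - v n| ≤ K) →
      limsup (fun n : ℕ => u n / n) atTop ≤ limsup (fun n : ℕ => v n / n) atTop ∧
      liminf (fun n : ℕ => u n / n) atTop ≤ liminf (fun n : ℕ => v n / n) atTop := by
    intro u v hu hv huv
    have h0 : Tendsto (fun n : ℕ => (u n - v n) / n) atTop (𝓝 0) := by
      refine squeeze_zero_norm (a := fun n : ℕ => K / n) (fun n => ?_)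
        (tendsto_const_div_atTop_nhds_zero_nat K)
      rw [norm_div, Real.norm_eq_abs, Real.norm_natCast]
      gcongr
      exact huv n
    have hsum : (fun n : ℕ => u n / n) = (fun n : ℕ => v n / n) + fun n : ℕ => (u n - v n) / n := by
      ext n
      simp only [Pi.add_apply]
      ring
    have b1 : IsBoundedUnder (· ≤ ·) atTop (fun n : ℕ => v n / n) :=
      isBoundedUnder_of ⟨C, fun n => (abs_le.1 (hv n)).2⟩
    have b2 : IsBoundedUnder (· ≥ ·) atTop (fun n : ℕ => v n / n) :=
      isBoundedUnder_of ⟨-C, fun n => (abs_le.1 (hv n)).1⟩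
    constructor
    · rw [hsum]
      refine (limsup_add_le b2 b1 h0.isBoundedUnder_ge.isCoboundedUnder_le
        h0.isBoundedUnder_le).trans ?_
      rw [h0.limsup_eq, add_zero]
    · rw [hsum, add_comm]
      refine (liminf_add_le h0.isBoundedUnder_ge h0.isBoundedUnder_le b2
        b1.isCoboundedUnder_ge).trans ?_
      rw [h0.limsup_eq, zero_add]
  have huv' : ∀ n, |v n - u n| ≤ K := fun n => by rw [abs_sub_comm]; exact huv n
  exact ⟨(key hu hv huv).1.antisymm (key hv hu huv').1,
    (key hu hv huv).2.antisymm (key hv hu huv').2⟩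

variable {Ω : Type*} {T : Ω → Ω}

/-- Covering argument: follow the orbit of `ω` along blocks on which the average of `g` is at most
`h + ε`; the orbit points in `B`, where no such block of length at most `L` starts, are charged
separately. -/
lemma subadditive_le_birkhoffSum {g : ℕ → Ω → ℝ} {h : Ω → ℝ} {C ε : ℝ} {L : ℕ} {B : Set Ω}
    (hC : 0 ≤ C) (hε : 0 ≤ ε) (hg : ∀ n ω, g n ω ≤ C * n)
    (hsub : ∀ m n ω, g (m + n) ω ≤ g m ω + g n (T^[m] ω))
    (hT : ∀ ω, h (T ω) = h ω) (hh : ∀ ω, -C ≤ h ω)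
    (hB : ∀ ω, ω ∉ B → ∃ n, 0 < n ∧ n ≤ L ∧ g n ω ≤ n * (h ω + ε)) (n : ℕ) (ω : Ω) :
    g n ω ≤ n * (h ω + ε) + 2 * C * birkhoffSum T (B.indicator 1) n ω + 2 * C * L := by
  have hTn : ∀ n ω, h (T^[n] ω) = h ω := by
    intro n
    induction n with
    | zero => intro ω; rfl
    | succ n ih => intro ω; rw [Function.iterate_succ_apply, ih, hT]
  have hbs : ∀ n ω, 0 ≤ birkhoffSum T (B.indicator (1 : Ω → ℝ)) n ω := fun n ω =>
    Finset.sum_nonneg fun _ _ => Set.indicator_nonneg (fun _ _ => zero_le_one) _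
  induction n using Nat.strong_induction_on generalizing ω with
  | _ n ih =>
  -- Split off a first block of length `m` and apply induction from `T^[m] ω`, where `h` is
  -- unchanged.
  have step : ∀ m, 0 < m → m ≤ n →
      g m ω ≤ m * (h ω + ε) + 2 * C * birkhoffSum T (B.indicator 1) m ω →
      g n ω ≤ n * (h ω + ε) + 2 * C * birkhoffSum T (B.indicator 1) n ω + 2 * C * L := by
    intro m hm hmn hgm
    obtain ⟨k, rfl⟩ := Nat.exists_eq_add_of_le hmn
    have h1 := ih k (by omega) (T^[m] ω)
    have h2 := hsub m k ω
    rw [hTn] at h1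
    rw [birkhoffSum_add]
    push_cast
    linarith
  -- The final stretch, of length at most `L`, is bounded trivially: `C * n` exceeds `n * (h ω + ε)`
  -- by at most `2 * C * L`. A point of `B` is a block of length one with excess at most `2 * C`.
  rcases le_or_gt n L with hnL | hnL
  · have h1 := hg n ω
    have h2 := mul_nonneg hC (hbs n ω)
    have h3 : -C * n ≤ n * (h ω + ε) := by
      rw [mul_comm]
      exact mul_le_mul_of_nonneg_left (by linarith [hh ω]) n.cast_nonneg
    have h4 : C * n ≤ C * L := mul_le_mul_of_nonneg_left (by exact_mod_cast hnL) hC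
    linarith
  · by_cases hω : ω ∈ B
    · refine step 1 one_pos (by omega) ?_
      have h1 := hg 1 ω
      have h2 := hh ω
      simp only [birkhoffSum_one, Set.indicator_of_mem hω, Pi.one_apply]
      push_cast at *
      linarith
    · obtain ⟨m, hm, hmL, hgm⟩ := hB ω hω
      refine step m hm (by omega) ?_
      have := mul_nonneg hC (hbs m ω)
      linarith

variable [MeasurableSpace Ω] {μ : Measure Ω}

lemma integral_birkhoffSum (hT : MeasurePreserving T μ μ) {f : Ω → ℝ} (hf : Integrable f μ)
    (n : ℕ) : ∫ ω, birkhoffSum T f n ω ∂μ = n * ∫ ω, f ω ∂μ := by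
  simp only [birkhoffSum]
  rw [integral_finsetSum (f := fun k ω => f (T^[k] ω)) _ fun k _ =>
    (hT.iterate k).integrable_comp_of_integrable hf]
  have : ∀ k, ∫ ω, f (T^[k] ω) ∂μ = ∫ ω, f ω ∂μ := fun k => by
    have hk := (hT.iterate k).map_eq
    have := integral_map (μ := μ) (f := f) (hT.iterate k).measurable.aemeasurable
      (by rw [hk]; exact hf.1)
    rw [← this, hk]
  simp [this]

/-- If the averages of a bounded subadditive process come arbitrarily close to an invariant
function `h` from above, then its mean averages are asymptotically at most the mean of `h`. -/
lemma eventually_integral_subadditive_le [IsProbabilityMeasure μ] (hT : MeasurePreserving T μ μ)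
    {g : ℕ → Ω → ℝ} {h : Ω → ℝ} {C : ℝ} (hC : 0 ≤ C) (hgm : ∀ n, Measurable (g n))
    (hg : ∀ n ω, |g n ω| ≤ C * n) (hsub : ∀ m n ω, g (m + n) ω ≤ g m ω + g n (T^[m] ω))
    (hhm : Measurable h) (hhT : ∀ ω, h (T ω) = h ω) (hh : ∀ ω, |h ω| ≤ C)
    (hgh : ∀ ω ε, 0 < ε → ∃ n, 0 < n ∧ g n ω ≤ n * (h ω + ε)) {δ : ℝ} (hδ : 0 < δ) :
    ∀ᶠ n : ℕ in atTop, ∫ ω, g n ω ∂μ ≤ n * (∫ ω, h ω ∂μ + δ) := by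
  -- With `μ (B L) < ε`, the slack and the bad points cost at most `δ / 2` per step; the other `δ /
  -- 2` absorbs `2 * C * L` for large `n`.
  set ε : ℝ := δ / (4 * (1 + C)) with hεdef
  have hε : 0 < ε := by positivity
  have hεδ : ε + 2 * C * ε ≤ δ / 2 := by
    have : 4 * (1 + C) * ε = δ := by rw [hεdef]; field_simp
    nlinarith
  -- Points without a good block of length at most `L`. These sets decrease to the empty set, so
  -- their measures tend to zero.
  let B : ℕ → Set Ω := fun L => ⋂ n ∈ Finset.Icc 1 L, {ω | n * (h ω + ε) < g n ω}
  have hBm : ∀ L, MeasurableSet (B L) := fun L =>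
    Finset.measurableSet_biInter _ fun n _ => measurableSet_lt (by fun_prop) (hgm n)
  have hBanti : Antitone B := fun L L' hL => by
    refine Set.biInter_subset_biInter_left fun n hn => ?_
    simp only [Finset.coe_Icc, Set.mem_Icc] at hn ⊢
    omega
  have hBinter : ⋂ L, B L = ∅ := by
    refine Set.eq_empty_iff_forall_notMem.2 fun ω hω => ?_
    obtain ⟨n, hn, hle⟩ := hgh ω ε hε
    have := Set.mem_iInter.1 hω n
    simp only [B, Set.mem_iInter, Finset.mem_Icc] at this
    exact absurd (this n ⟨hn, le_rfl⟩) (not_lt.2 hle)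
  have hlim := tendsto_measure_iInter_atTop (μ := μ) (fun L => (hBm L).nullMeasurableSet) hBanti
    ⟨0, measure_ne_top _ _⟩
  rw [hBinter, measure_empty] at hlim
  obtain ⟨L, hL⟩ := ((ENNReal.tendsto_toReal ENNReal.zero_ne_top).comp hlim |>.eventually
    (gt_mem_nhds hε)).exists
  have hcov := fun n ω => subadditive_le_birkhoffSum (T := T) (B := B L) (L := L) hC hε.le
    (fun n ω => (abs_le.1 (hg n ω)).2) hsub hhT (fun ω => (abs_le.1 (hh ω)).1) (fun ω hω => by
      simp only [B, Set.mem_iInter, Finset.mem_Icc, not_forall] at hω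
      obtain ⟨n, hn, hlt⟩ := hω
      exact ⟨n, hn.1, hn.2, not_lt.1 hlt⟩) n ω
  have hgi : ∀ n, Integrable (g n) μ := fun n =>
    .of_bound (hgm n).aestronglyMeasurable (C * n) (.of_forall (hg n))
  have hhi : Integrable h μ := .of_bound hhm.aestronglyMeasurable C (.of_forall hh)
  have hBi : Integrable ((B L).indicator (1 : Ω → ℝ)) μ :=
    (integrable_const (1 : ℝ)).indicator (hBm L)
  have hbi : ∀ n, Integrable (birkhoffSum T ((B L).indicator (1 : Ω → ℝ)) n) μ := fun n =>
    integrable_finsetSum _ fun k _ => (hT.iterate k).integrable_comp_of_integrable hBi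
  have hint : ∀ n : ℕ, ∫ ω, g n ω ∂μ ≤
      n * (∫ ω, h ω ∂μ + ε) + 2 * C * (n * μ.real (B L)) + 2 * C * L := by
    intro n
    have h1 : Integrable (fun ω => (n : ℝ) * (h ω + ε)) μ :=
      (hhi.add (integrable_const ε)).const_mul _
    have h2 := (hbi n).const_mul (2 * C)
    have h12 : Integrable (fun ω => n * (h ω + ε) +
        2 * C * birkhoffSum T ((B L).indicator 1) n ω) μ := h1.add h2
    have h3 := integral_mono (hgi n) (h12.add (integrable_const (2 * C * L))) (hcov n)
    refine h3.trans (le_of_eq ?_)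
    simp only [Pi.add_apply]
    rw [integral_add h12 (integrable_const _), integral_add h1 h2, integral_const_mul,
      integral_const_mul, integral_birkhoffSum hT hBi, integral_indicator_one (hBm L),
      integral_add hhi (integrable_const _)]
    simp
  obtain ⟨N, hN⟩ := exists_nat_ge (2 * C * L / (δ / 2))
  filter_upwards [eventually_ge_atTop N] with n hn
  have hn' : (N : ℝ) ≤ n := by exact_mod_cast hn
  have h1 : 2 * C * L ≤ n * (δ / 2) := by
    rw [div_le_iff₀ (by positivity)] at hN
    exact hN.trans (by gcongr)
  have hL' : μ.real (B L) ≤ ε := le_of_lt hL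
  have h2 : 2 * C * (n * μ.real (B L)) ≤ 2 * C * (n * ε) := by gcongr
  have h3 : (n : ℝ) * (ε + 2 * C * ε) ≤ n * (δ / 2) := by gcongr
  have := hint n
  linarith

/-- Kingman's subadditive ergodic theorem for a bounded process which is invariant up to a bounded
error. -/
theorem ae_exists_tendsto_of_subadditive [IsProbabilityMeasure μ] (hT : MeasurePreserving T μ μ)
    {g : ℕ → Ω → ℝ} {C K : ℝ} (hC : 0 ≤ C) (hgm : ∀ n, Measurable (g n))
    (hg : ∀ n ω, |g n ω| ≤ C * n) (hsub : ∀ m n ω, g (m + n) ω ≤ g m ω + g n (T^[m] ω))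
    (hinv : ∀ n ω, |g n (T ω) - g n ω| ≤ K) :
    ∀ᵐ ω ∂μ, ∃ l, Tendsto (fun n : ℕ => g n ω / n) atTop (𝓝 l) := by
  have hgC : ∀ ω (n : ℕ), |g n ω / n| ≤ C := fun ω n => by
    rcases n.eq_zero_or_pos with rfl | hn
    · simpa using hC
    · rw [abs_div, Nat.abs_cast, div_le_iff₀ (by positivity)]
      exact hg n ω
  have bU : ∀ ω, IsBoundedUnder (· ≤ ·) atTop (fun n : ℕ => g n ω / n) := fun ω =>
    isBoundedUnder_of ⟨C, fun n => (abs_le.1 (hgC ω n)).2⟩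
  have bL : ∀ ω, IsBoundedUnder (· ≥ ·) atTop (fun n : ℕ => g n ω / n) := fun ω =>
    isBoundedUnder_of ⟨-C, fun n => (abs_le.1 (hgC ω n)).1⟩
  let S : Ω → ℝ := fun ω => limsup (fun n : ℕ => g n ω / n) atTop
  let I : Ω → ℝ := fun ω => liminf (fun n : ℕ => g n ω / n) atTop
  have hSm : Measurable S := Measurable.limsup fun n => (hgm n).div_const _
  have hIm : Measurable I := Measurable.liminf fun n => (hgm n).div_const _
  have hST : ∀ ω, S (T ω) = S ω := fun ω =>
    (limsup_div_eq_of_bounded_sub (hgC (T ω)) (hgC ω) (fun n => hinv n ω)).1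
  have hIT : ∀ ω, I (T ω) = I ω := fun ω =>
    (limsup_div_eq_of_bounded_sub (hgC (T ω)) (hgC ω) (fun n => hinv n ω)).2
  have hIS : ∀ ω, I ω ≤ S ω := fun ω => liminf_le_limsup (bU ω) (bL ω)
  have hSC : ∀ ω, S ω ≤ C := fun ω => limsup_le_of_le (bL ω).isCoboundedUnder_le
    (.of_forall fun n => (abs_le.1 (hgC ω n)).2)
  have hIC : ∀ ω, -C ≤ I ω := fun ω => le_liminf_of_le (bU ω).isCoboundedUnder_ge
    (.of_forall fun n => (abs_le.1 (hgC ω n)).1)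
  have hSabs : ∀ ω, |S ω| ≤ C := fun ω => abs_le.2 ⟨(hIC ω).trans (hIS ω), hSC ω⟩
  have hIabs : ∀ ω, |I ω| ≤ C := fun ω => abs_le.2 ⟨hIC ω, (hIS ω).trans (hSC ω)⟩
  have hSi : Integrable S μ := .of_bound hSm.aestronglyMeasurable C (.of_forall hSabs)
  have hIi : Integrable I μ := .of_bound hIm.aestronglyMeasurable C (.of_forall hIabs)
  have hgi : ∀ n, Integrable (g n) μ := fun n =>
    .of_bound (hgm n).aestronglyMeasurable (C * n) (.of_forall (hg n))
  have lower : ∀ δ > 0, ∀ᶠ n : ℕ in atTop, ∫ ω, g n ω ∂μ ≤ n * (∫ ω, I ω ∂μ + δ) := by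
    intro δ hδ
    refine eventually_integral_subadditive_le hT hC hgm hg hsub hIm hIT hIabs ?_ hδ
    intro ω ε hε
    have h1 : ∃ᶠ n : ℕ in atTop, g n ω / n < I ω + ε :=
      frequently_lt_of_liminf_lt (bU ω).isCoboundedUnder_ge (lt_add_of_pos_right _ hε)
    obtain ⟨n, hn, hpos⟩ := (h1.and_eventually (eventually_gt_atTop 0)).exists
    refine ⟨n, hpos, ?_⟩
    rw [div_lt_iff₀ (by exact_mod_cast hpos)] at hn
    linarith
  have hiter : ∀ m q ω, g (q * m) ω ≤ birkhoffSum T^[m] (g m) q ω := by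
    intro m q
    induction q with
    | zero =>
      intro ω
      simpa using (abs_le.1 (hg 0 ω)).2
    | succ q ih =>
      intro ω
      rw [add_mul, one_mul, birkhoffSum_succ, ← Function.iterate_mul, mul_comm m q]
      exact (hsub _ _ _).trans (by linarith [ih ω])
  -- The same covering bound, applied to minus the Birkhoff sums of `g m` under `T^[m]`: these are
  -- additive, so the sign change keeps subadditivity. They dominate `g (q * m)`, so their averages
  -- come close to `m * S` or above it infinitely often.
  have upper : ∀ m : ℕ, 0 < m → m * ∫ ω, S ω ∂μ ≤ ∫ ω, g m ω ∂μ := by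
    intro m hm
    have hm' : (0 : ℝ) < m := by exact_mod_cast hm
    refine le_of_forall_pos_le_add fun δ hδ => ?_
    have key := eventually_integral_subadditive_le (hT.iterate m)
      (g := fun q ω => -birkhoffSum T^[m] (g m) q ω) (h := fun ω => -(m * S ω)) (C := C * m)
      (by positivity)
      (fun q => (Finset.measurable_sum _ fun k _ =>
        (hgm m).comp ((hT.iterate m).iterate k).measurable).neg)
      (fun q ω => by
        rw [abs_neg]
        refine (Finset.abs_sum_le_sum_abs _ _).trans ?_
        refine (Finset.sum_le_sum fun k _ => hg m _).trans (le_of_eq ?_)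
        simp [mul_comm])
      (fun p q ω => by
        rw [birkhoffSum_add]
        linarith)
      (by fun_prop)
      (fun ω => by
        have : ∀ n, S (T^[n] ω) = S ω := fun n => by
          induction n with
          | zero => rfl
          | succ n ih => rw [Function.iterate_succ_apply', hST, ih]
        rw [this])
      (fun ω => by
        rw [abs_neg, abs_mul, Nat.abs_cast, mul_comm]
        exact mul_le_mul_of_nonneg_right (hSabs ω) hm'.le)
      (fun ω ε hε => by
        have h1 : ∃ᶠ n : ℕ in atTop, S ω - ε / (2 * m) < g n ω / n :=
          frequently_lt_of_lt_limsup (bL ω).isCoboundedUnder_le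
            (sub_lt_self _ (by positivity))
        -- Write `n = q * m + r`. The remainder costs `C * m` in `g r`, `C * m` in `r * S` and `ε /
        -- 2` in the slack; `q ≥ N` makes `q * (ε / 2)` cover all three.
        obtain ⟨N, hN⟩ := exists_nat_ge ((2 * C * m + ε / 2) / (ε / 2))
        obtain ⟨n, hn, hnN⟩ := (h1.and_eventually (eventually_ge_atTop ((N + 1) * m))).exists
        have hq : N + 1 ≤ n / m := (Nat.le_div_iff_mul_le hm).2 hnN
        refine ⟨n / m, by omega, ?_⟩
        have hnpos : 0 < n := lt_of_lt_of_le (by positivity) hnN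
        rw [lt_div_iff₀ (by exact_mod_cast hnpos)] at hn
        have hrm : n % m < m := Nat.mod_lt _ hm
        have hdm : n / m * m + n % m = n := Nat.div_add_mod' n m
        have h2 := hsub (n / m * m) (n % m) ω
        rw [hdm] at h2
        have h3 := hiter m (n / m) ω
        have h4 := (abs_le.1 (hg (n % m) (T^[n / m * m] ω))).2
        have hrm' : ((n % m : ℕ) : ℝ) ≤ m := by exact_mod_cast hrm.le
        have hr0 : (0 : ℝ) ≤ ((n % m : ℕ) : ℝ) := Nat.cast_nonneg _
        have h5 : C * ((n % m : ℕ) : ℝ) ≤ C * m := by gcongr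
        have hq' : (N : ℝ) ≤ ((n / m : ℕ) : ℝ) := by exact_mod_cast (by omega : N ≤ n / m)
        have hdm' : ((n / m : ℕ) : ℝ) * m + ((n % m : ℕ) : ℝ) = n := by exact_mod_cast hdm
        generalize ((n / m : ℕ) : ℝ) = q at *
        generalize ((n % m : ℕ) : ℝ) = r at *
        rw [← hdm'] at hn
        have h6 : -(C * m) ≤ r * S ω := by
          have := mul_le_mul_of_nonneg_left (abs_le.1 (hSabs ω)).1 hr0
          linarith
        have h7 : (q * m + r) * (ε / (2 * m)) ≤ q * (ε / 2) + ε / 2 := by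
          have : (q * m + r) * (ε / (2 * m)) ≤ (q * m + m) * (ε / (2 * m)) := by gcongr
          refine this.trans (le_of_eq ?_)
          field_simp
        have h8 : 2 * C * m + ε / 2 ≤ q * (ε / 2) := by
          rw [div_le_iff₀ (by positivity)] at hN
          exact hN.trans (by gcongr)
        linarith)
      hδ
    obtain ⟨q, hq, hqpos⟩ := (key.and (eventually_gt_atTop 0)).exists
    have hq0 : (0 : ℝ) < q := by exact_mod_cast hqpos
    rw [integral_neg, integral_birkhoffSum (hT.iterate m) (hgi m), integral_neg,
      integral_const_mul, ← mul_neg] at hq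
    have := le_of_mul_le_mul_left hq hq0
    linarith
  have hle : ∫ ω, S ω ∂μ ≤ ∫ ω, I ω ∂μ := by
    refine le_of_forall_pos_le_add fun δ hδ => ?_
    obtain ⟨m, hm, hpos⟩ := ((lower δ hδ).and (eventually_gt_atTop 0)).exists
    exact le_of_mul_le_mul_left ((upper m hpos).trans hm) (by exact_mod_cast hpos)
  have hzero : ∫ ω, (S ω - I ω) ∂μ = 0 := by
    refine le_antisymm ?_ (integral_nonneg fun ω => sub_nonneg.2 (hIS ω))
    rw [integral_sub hSi hIi]
    linarith
  have hae := (integral_eq_zero_iff_of_nonneg (fun ω => sub_nonneg.2 (hIS ω))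
    (hSi.sub hIi)).1 hzero
  filter_upwards [hae] with ω hω
  have hω' : S ω = I ω := sub_eq_zero.1 hω
  exact ⟨S ω, tendsto_of_liminf_eq_limsup hω'.symm rfl (bU ω) (bL ω)⟩

end Kingman

/-! ### Existence of the time-constant -/

section TimeConstant

variable {d : ℕ}

lemma latticeDist_nsmul_zero (n : ℕ) (p : Fin d → ℤ) :
    latticeDist (n • p) 0 = n * latticeDist p 0 := by
  simp [latticeDist, Finset.mul_sum, abs_mul]

lemma abs_scaledPassageTime_le {t : Config d} {b : ℝ} (hb0 : 0 ≤ b) (h : ∀ x α, 0 ≤ t x α)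
    (hb : ∀ x α, t x α ≤ b) (n : ℕ) (x : Fin d → ℝ) :
    |scaledPassageTime t n x| ≤ b * (∑ i, |x i| + d) := by
  have hs : 0 ≤ ∑ i, |x i| := Finset.sum_nonneg fun _ _ => abs_nonneg _
  rw [scaledPassageTime, abs_div, abs_of_nonneg (passageTime_nonneg h _ _), Nat.abs_cast]
  rcases n.eq_zero_or_pos with rfl | hn
  · simp only [Nat.cast_zero, div_zero]
    positivity
  have hn' : (1 : ℝ) ≤ n := by exact_mod_cast hn
  rw [div_le_iff₀ (by linarith), mul_assoc]
  refine (passageTime_le_latticeDist h hb _ _).trans (mul_le_mul_of_nonneg_left ?_ hb0)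
  refine (latticeDist_nearestPoint_zero_le n x).trans ?_
  have : (d : ℝ) ≤ d * n := le_mul_of_one_le_right d.cast_nonneg hn'
  linarith

/-- If the limits exist along every lattice direction, then they exist in every real direction. -/
lemma exists_tendsto_scaledPassageTime {t : Config d} {b : ℝ} (hb0 : 0 ≤ b)
    (h : ∀ x α, 0 ≤ t x α) (hb : ∀ x α, t x α ≤ b)
    (hlim : ∀ p : Fin d → ℤ, ∃ l, Tendsto (fun n : ℕ => passageTime t (n • p) 0 / n) atTop (𝓝 l))
    (x : Fin d → ℝ) : ∃ l, Tendsto (fun n => scaledPassageTime t n x) atTop (𝓝 l) := by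
  refine cauchySeq_tendsto_of_complete (Metric.cauchySeq_iff.2 fun ε hε => ?_)
  -- Replace `x` by the rational point `p / q` and `[n x]` by `(n / q) • p`. The spatial error
  -- contributes `b * d / q` after division by `n`.
  obtain ⟨q, hq⟩ := exists_nat_gt (b * d / (ε / 4))
  have hq0 : (0 : ℝ) < q := lt_of_le_of_lt (by positivity) hq
  have hqN : 0 < q := by exact_mod_cast hq0
  have hqε : b * d / q ≤ ε / 4 := by
    rw [div_lt_iff₀ (by positivity)] at hq
    rw [div_le_iff₀ hq0]
    linarith
  let p : Fin d → ℤ := fun i => round (q * x i)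
  obtain ⟨l, hl⟩ := hlim p
  have hk : Tendsto (fun n : ℕ => n / q) atTop atTop := Nat.tendsto_div_const_atTop hqN.ne'
  have hkn : Tendsto (fun n : ℕ => ((n / q : ℕ) : ℝ) / n) atTop (𝓝 (1 / q)) := by
    refine ((tendsto_nat_floor_mul_div_atTop (R := ℝ) (a := 1 / q) (by positivity)).comp
      tendsto_natCast_atTop_atTop).congr fun n => ?_
    have : (1 / q * n : ℝ) = (n : ℝ) / q := by ring
    simp only [Function.comp_apply, this, Nat.floor_div_eq_div]
  have hG : Tendsto (fun n : ℕ => passageTime t ((n / q) • p) 0 / n) atTop (𝓝 (l * (1 / q))) := by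
    refine ((hl.comp hk).mul hkn).congr' ?_
    filter_upwards [hk.eventually_gt_atTop 0] with n hn
    have : ((n / q : ℕ) : ℝ) ≠ 0 := by exact_mod_cast hn.ne'
    simp only [Function.comp_apply]
    field_simp
  obtain ⟨N, hN⟩ := Metric.cauchySeq_iff.1 hG.cauchySeq (ε / 4) (by positivity)
  set M : ℝ := b * (∑ i, |(p i : ℝ)| + d) with hM
  obtain ⟨N', hN'⟩ := ((tendsto_const_div_atTop_nhds_zero_nat M).eventually
    (gt_mem_nhds (show 0 < ε / 16 by positivity))).exists_forall_of_atTop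
  have hFG : ∀ n ≥ max N' 1, |scaledPassageTime t n x - passageTime t ((n / q) • p) 0 / n|
      ≤ ε / 4 + ε / 16 := by
    intro n hn
    have hn0 : (0 : ℝ) < n := by exact_mod_cast (le_max_right _ _).trans hn
    -- Per coordinate, approximating `q * x i` by `p i` costs `n / q`, the integer division costs
    -- `|p i|`, and rounding `n * x i` costs one.
    have hdist : latticeDist (nearestPoint fun i => n * x i) ((n / q) • p)
        ≤ n * d / q + (∑ i, |(p i : ℝ)| + d) := by
      refine (latticeDist_nearestPoint_le _ _).trans ?_
      have : ∀ i, |(n : ℝ) * x i - (((n / q) • p) i : ℤ)| ≤ n / q + |(p i : ℝ)| := by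
        intro i
        have h1 : |(q : ℝ) * x i - p i| ≤ 1 := (abs_sub_round _).trans (by norm_num)
        have h2 : |(n : ℝ) / q - ((n / q : ℕ) : ℝ)| ≤ 1 := by
          rw [← Nat.floor_div_eq_div (K := ℝ), abs_le]
          have h3 := Nat.floor_le (show (0 : ℝ) ≤ n / q by positivity)
          have h4 := Nat.lt_floor_add_one ((n : ℝ) / q)
          constructor <;> linarith
        have h5 : (n : ℝ) * x i - (((n / q) • p) i : ℤ)
            = n / q * (q * x i - p i) + ((n : ℝ) / q - ((n / q : ℕ) : ℝ)) * p i := by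
          rw [Pi.smul_apply, nsmul_eq_mul, Int.cast_mul, Int.cast_natCast]
          field_simp
          ring
        rw [h5]
        refine (abs_add_le _ _).trans ?_
        rw [abs_mul, abs_mul, abs_of_nonneg (show (0 : ℝ) ≤ n / q by positivity)]
        exact add_le_add (mul_le_of_le_one_right (by positivity) h1)
          (mul_le_of_le_one_left (abs_nonneg _) h2)
      have h6 : ∑ i, ((n : ℝ) / q + |(p i : ℝ)|) = n * d / q + ∑ i, |(p i : ℝ)| := by
        rw [Finset.sum_add_distrib, Finset.sum_const, Finset.card_univ, Fintype.card_fin,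
          nsmul_eq_mul]
        ring
      rw [← add_assoc, ← h6]
      exact add_le_add_left (Finset.sum_le_sum fun i _ => this i) _
    rw [scaledPassageTime, ← sub_div, abs_div, Nat.abs_cast]
    have h8 := (abs_passageTime_sub_le h hb (nearestPoint fun i => n * x i) 0 ((n / q) • p) 0)
    have h9 : latticeDist (0 : Fin d → ℤ) 0 = 0 := by simp [latticeDist]
    rw [h9, add_zero] at h8
    have h10 : b * d / q + M / n ≤ ε / 4 + ε / 16 :=
      add_le_add hqε (hN' n ((le_max_left _ _).trans hn)).le
    refine le_trans ?_ h10
    rw [div_le_iff₀ hn0]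
    refine (h8.trans (mul_le_mul_of_nonneg_left hdist hb0)).trans (le_of_eq ?_)
    rw [hM]
    field_simp
  refine ⟨max N (max N' 1), fun m hm n hn => ?_⟩
  have h1 := hFG m ((le_max_right _ _).trans hm)
  have h2 := hFG n ((le_max_right _ _).trans hn)
  have h3 := hN m ((le_max_left _ _).trans hm) n ((le_max_left _ _).trans hn)
  rw [Real.dist_eq] at h3 ⊢
  rw [abs_le] at h1 h2
  rw [abs_lt] at h3 ⊢
  constructor <;> linarith

variable {Ω : Type*}

lemma measurable_sample [MeasurableSpace Ω] {τ : (Fin d → ℤ) → directions d → Ω → ℝ}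
    (h : ∀ x α, Measurable (τ x α)) : Measurable (sample τ) :=
  measurable_pi_lambda _ fun x => measurable_pi_lambda _ fun α => h x α

lemma passageTime_sample_vadd [MeasurableSpace Ω] [VAdd (Fin d → ℤ) Ω]
    {τ : (Fin d → ℤ) → directions d → Ω → ℝ} (h : IsStationary τ) (x y z : Fin d → ℤ) (ω : Ω) :
    passageTime (sample τ (z +ᵥ ω)) x y = passageTime (sample τ ω) (x + z) (y + z) := by
  rw [← passageTime_shift]
  congr 1
  ext u α
  exact (h.stationary u z α ω).symm

/-- Preimages of measurable sets are invariant, hence null or conull, and measurable sets of reals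
are countably separated. -/
lemma exists_ae_eq_const_of_vadd_invariant {G : Type*} [VAdd G Ω] [MeasurableSpace Ω]
    {P : Measure Ω} [ErgodicVAdd G Ω P] {f : Ω → ℝ} (hf : Measurable f)
    (hinv : ∀ (z : G) ω, f (z +ᵥ ω) = f ω) : ∃ c, ∀ᵐ ω ∂P, f ω = c := by
  refine exists_eventuallyEq_const_of_forall_separating MeasurableSet fun U hU => ?_
  have := aeconst_of_forall_preimage_vadd_ae_eq G (μ := P) (hf hU).nullMeasurableSet fun z => by
    rw [show (z +ᵥ ·) ⁻¹' (f ⁻¹' U) = f ⁻¹' U from Set.ext fun ω => by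
      simp only [Set.mem_preimage, hinv]]
    exact EventuallyEq.rfl
  exact eventuallyConst_set.1 this

/-- Existence of the time constant for weights which are everywhere nonnegative and bounded. -/
lemma exists_isTimeConstant_of_forall_mem [MeasurableSpace Ω] {P : Measure Ω}
    [IsProbabilityMeasure P] [AddAction (Fin d → ℤ) Ω] [MeasurableConstVAdd (Fin d → ℤ) Ω]
    [ErgodicVAdd (Fin d → ℤ) Ω P] {τ : (Fin d → ℤ) → directions d → Ω → ℝ}
    (hτ : IsStationary τ) {b : ℝ} (hb0 : 0 ≤ b) (h : ∀ x α ω, 0 ≤ τ x α ω)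
    (hb : ∀ x α ω, τ x α ω ≤ b) : ∃ m, IsTimeConstant P τ m := by
  have h' : ∀ ω x α, 0 ≤ sample τ ω x α := fun ω x α => h x α ω
  have hb' : ∀ ω x α, sample τ ω x α ≤ b := fun ω x α => hb x α ω
  have hsm : Measurable (sample τ) := measurable_sample hτ.measurable
  -- Shifting the environment by `z` amounts to moving both endpoints by `z`.
  have shift : ∀ (z x y : Fin d → ℤ) (ω : Ω),
      |passageTime (sample τ (z +ᵥ ω)) x y - passageTime (sample τ ω) x y|
        ≤ b * (2 * latticeDist z 0) := by
    intro z x y ω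
    rw [passageTime_sample_vadd hτ]
    refine (abs_passageTime_sub_le (h' ω) (hb' ω) _ _ _ _).trans (le_of_eq ?_)
    have : ∀ x : Fin d → ℤ, latticeDist (x + z) x = latticeDist z 0 := fun x => by
      simpa [add_comm] using latticeDist_add_right z 0 x
    rw [this, this]
    ring
  have hlattice : ∀ p : Fin d → ℤ, ∀ᵐ ω ∂P, ∃ l, Tendsto
      (fun n : ℕ => passageTime (sample τ ω) (n • p) 0 / n) atTop (𝓝 l) := by
    intro p
    refine ae_exists_tendsto_of_subadditive (T := fun ω => p +ᵥ ω)
      (measurePreserving_vadd p P) (g := fun n ω => passageTime (sample τ ω) (n • p) 0)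
      (C := b * latticeDist p 0) (K := b * (2 * latticeDist p 0))
      (mul_nonneg hb0 (latticeDist_nonneg _ _))
      (fun n => (measurable_passageTime _ _).comp hsm) (fun n ω => ?_) (fun m n ω => ?_)
      (fun n ω => shift p _ _ ω)
    · rw [abs_of_nonneg (passageTime_nonneg (h' ω) _ _), mul_assoc, mul_comm _ (n : ℝ),
        ← latticeDist_nsmul_zero]
      exact passageTime_le_latticeDist (h' ω) (hb' ω) _ _
    -- Subadditivity is the triangle inequality through the intermediate point `m • p`.
    · have h1 : (fun ω : Ω => p +ᵥ ω)^[m] ω = (m • p) +ᵥ ω := by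
        rw [vadd_iterate]
      rw [h1, passageTime_sample_vadd hτ, zero_add, ← add_nsmul, add_comm m n]
      exact (passageTime_triangle (h' ω) _ _ _).trans_eq (add_comm _ _)
  have hlim : ∀ᵐ ω ∂P, ∀ x : Fin d → ℝ,
      ∃ l, Tendsto (fun n => scaledPassageTime (sample τ ω) n x) atTop (𝓝 l) := by
    filter_upwards [ae_all_iff.2 hlattice] with ω hω
    exact exists_tendsto_scaledPassageTime hb0 (h' ω) (hb' ω) hω
  have hconst : ∀ x : Fin d → ℝ, ∃ c, ∀ᵐ ω ∂P,
      limsup (fun n => scaledPassageTime (sample τ ω) n x) atTop = c := by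
    intro x
    refine exists_ae_eq_const_of_vadd_invariant (G := Fin d → ℤ)
      (Measurable.limsup fun n => (measurable_scaledPassageTime n x).comp hsm) fun z ω => ?_
    exact (limsup_div_eq_of_bounded_sub
      (fun n => abs_scaledPassageTime_le hb0 (h' (z +ᵥ ω)) (hb' (z +ᵥ ω)) n x)
      (fun n => abs_scaledPassageTime_le hb0 (h' ω) (hb' ω) n x)
      (fun n => shift z _ _ ω)).1
  choose m hm using hconst
  refine ⟨m, fun x => ?_⟩
  filter_upwards [hlim, hm x] with ω hω hmx
  obtain ⟨l, hl⟩ := hω x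
  rwa [← hmx, hl.limsup_eq]

/-- Existence of the time constant for weights which are almost surely nonnegative and bounded. -/
theorem exists_isTimeConstant [MeasurableSpace Ω] {P : Measure Ω}
    [IsProbabilityMeasure P] [AddAction (Fin d → ℤ) Ω] [MeasurableConstVAdd (Fin d → ℤ) Ω]
    [ErgodicVAdd (Fin d → ℤ) Ω P] {τ : (Fin d → ℤ) → directions d → Ω → ℝ}
    (hτ : IsStationary τ) {b : ℝ} (h : ∀ᵐ ω ∂P, ∀ x α, 0 ≤ τ x α ω ∧ τ x α ω ≤ b) :
    ∃ m, IsTimeConstant P τ m := by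
  -- Clamping makes the bounds hold everywhere, keeps stationarity, and changes the configuration
  -- only on a null set.
  let σ : (Fin d → ℤ) → directions d → Ω → ℝ := fun x α ω => max 0 (min (max b 0) (τ x α ω))
  have hσ : IsStationary σ :=
    ⟨fun x α => measurable_const.max (measurable_const.min (hτ.measurable x α)),
      fun x z α ω => by simp only [σ, hτ.stationary x z α ω]⟩
  obtain ⟨m, hm⟩ := exists_isTimeConstant_of_forall_mem (P := P) hσ (le_max_right b 0)
    (fun x α ω => le_max_left _ _)
    (fun x α ω => max_le (le_max_right _ _) (min_le_left _ _))
  refine ⟨m, fun x => ?_⟩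
  filter_upwards [hm x, h] with ω hω hτω
  have : sample τ ω = sample σ ω := by
    ext y α
    obtain ⟨h1, h2⟩ := hτω y α
    simp only [sample, σ]
    rw [min_eq_right (h2.trans (le_max_left _ _)), max_eq_right h1]
  rwa [this]

end TimeConstant

/-! ### Comparison of time-constants through couplings -/

section Comparison

variable {d : ℕ} {Ω : Type*} [MeasurableSpace Ω] {P : Measure Ω}
  {τ : (Fin d → ℤ) → directions d → Ω → ℝ}

lemma HasEssBounds.ae_mem {a b : ℝ} (h : HasEssBounds P τ a b) :
    ∀ᵐ ω ∂P, ∀ x α, a ≤ τ x α ω ∧ τ x α ω ≤ b :=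
  ae_all_iff.2 fun x => ae_all_iff.2 fun α => (h.essInf.1 x α).and (h.essSup.1 x α)

lemma ae_law (hτ : ∀ x α, Measurable (τ x α)) {p : Config d → Prop}
    (hp : MeasurableSet {t | p t}) (h : ∀ᵐ ω ∂P, p (sample τ ω)) : ∀ᵐ t ∂law P τ, p t :=
  (ae_map_iff (measurable_sample hτ).aemeasurable hp).2 h

lemma HasEssBounds.ae_law_mem {a b : ℝ} (h : HasEssBounds P τ a b)
    (hτ : ∀ x α, Measurable (τ x α)) : ∀ᵐ t ∂law P τ, ∀ x α, a ≤ t x α ∧ t x α ≤ b := by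
  refine ae_law hτ ?_ h.ae_mem
  simp only [Set.ofPred_forall]
  refine MeasurableSet.iInter fun x => MeasurableSet.iInter fun α => ?_
  have : Measurable fun t : Config d => t x α := by fun_prop
  exact (measurableSet_le measurable_const this).inter (measurableSet_le this measurable_const)

lemma IsTimeConstant.ae_law_tendsto {m : (Fin d → ℝ) → ℝ} (hm : IsTimeConstant P τ m)
    (hτ : ∀ x α, Measurable (τ x α)) (x : Fin d → ℝ) :
    ∀ᵐ t ∂law P τ, Tendsto (fun n => scaledPassageTime t n x) atTop (𝓝 (m x)) :=
  ae_law hτ (measurableSet_tendsto _ fun n => measurable_scaledPassageTime n x) (hm x)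

lemma isProbabilityMeasure_law [IsProbabilityMeasure P] (hτ : ∀ x α, Measurable (τ x α)) :
    IsProbabilityMeasure (law P τ) :=
  Measure.isProbabilityMeasure_map (measurable_sample hτ).aemeasurable

/-- Rounding `n * x` adds at most `d` to the distance, which vanishes after division by `n`. -/
lemma le_of_tendsto_scaledPassageTime {t t' : Config d} {a b δ l l' : ℝ} (ha : 0 < a)
    (hδ : 0 ≤ δ) (h : ∀ x α, 0 ≤ t x α) (ht' : ∀ x α, a ≤ t' x α ∧ t' x α ≤ b)
    (htt' : ∀ x α, t x α ≤ t' x α + δ) (hab : 0 ≤ b) {x : Fin d → ℝ}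
    (hl : Tendsto (fun n => scaledPassageTime t n x) atTop (𝓝 l))
    (hl' : Tendsto (fun n => scaledPassageTime t' n x) atTop (𝓝 l')) :
    l ≤ l' + b / a * δ * ∑ i, |x i| := by
  have h0 := tendsto_const_div_atTop_nhds_zero_nat (b / a * δ * (d : ℝ))
  have h1 := (hl'.add_const (b / a * δ * ∑ i, |x i|)).add h0
  rw [add_zero] at h1
  refine le_of_tendsto_of_tendsto hl h1 ?_
  filter_upwards [eventually_gt_atTop 0] with n hn
  have hn' : (0 : ℝ) < n := by exact_mod_cast hn
  have h2 := passageTime_le_add ha hδ h (fun x α => (ht' x α).1) (fun x α => (ht' x α).2) htt'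
    (nearestPoint fun i => n * x i) 0
  have h3 := mul_le_mul_of_nonneg_left (latticeDist_nearestPoint_zero_le n x)
    (show 0 ≤ b / a * δ by positivity)
  simp only [scaledPassageTime]
  rw [div_le_iff₀ hn', add_mul, add_mul, div_mul_cancel₀ _ hn'.ne', div_mul_cancel₀ _ hn'.ne']
  linarith

lemma ae_of_mem_couplings {X : Type*} [MeasurableSpace X] {P Q : Measure X}
    {π : Measure (X × X)} (hπ : π ∈ couplings P Q) {p q : X → Prop} (hp : ∀ᵐ x ∂P, p x)
    (hq : ∀ᵐ x ∂Q, q x) : ∀ᵐ x ∂π, p x.1 ∧ q x.2 := by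
  rw [← hπ.1] at hp
  rw [← hπ.2] at hq
  exact (ae_of_ae_map measurable_fst.aemeasurable hp).and
    (ae_of_ae_map measurable_snd.aemeasurable hq)

/-- The product coupling already has finite cost. Finiteness matters because `toReal` would send `⊤`
to `0`. -/
lemma couplingDist_ne_top {P Q : Measure (Config d)} [IsProbabilityMeasure P]
    [IsProbabilityMeasure Q] {a b a' b' : ℝ} (hP : ∀ᵐ t ∂P, ∀ x α, a ≤ t x α ∧ t x α ≤ b)
    (hQ : ∀ᵐ t ∂Q, ∀ x α, a' ≤ t x α ∧ t x α ≤ b') : couplingDist P Q ≠ ⊤ := by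
  have hmem : P.prod Q ∈ couplings P Q := ⟨by simp, by simp⟩
  refine ne_top_of_le_ne_top (b := ENNReal.ofReal (max (b - a') (b' - a))) ENNReal.ofReal_ne_top
    ((iInf₂_le _ hmem).trans ?_)
  refine essSup_le_of_ae_le _ ?_
  filter_upwards [ae_of_mem_couplings hmem hP hQ] with t ht
  refine iSup_le fun x => iSup_le fun α => ?_
  rw [edist_dist, Real.dist_eq]
  refine ENNReal.ofReal_le_ofReal (abs_le'.2 ⟨le_max_of_le_left ?_, le_max_of_le_right ?_⟩) <;>
    linarith [(ht.1 x α).1, (ht.1 x α).2, (ht.2 x α).1, (ht.2 x α).2]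

end Comparison

end FPP

theorem mainTheorem9 {d : ℕ} {Ω₁ Ω₂ : Type*}
    [MeasurableSpace Ω₁] (P₁ : Measure Ω₁) [IsProbabilityMeasure P₁]
    [AddAction (Fin d → ℤ) Ω₁] [MeasurableConstVAdd (Fin d → ℤ) Ω₁]
    [ErgodicVAdd (Fin d → ℤ) Ω₁ P₁]
    [MeasurableSpace Ω₂] (P₂ : Measure Ω₂) [IsProbabilityMeasure P₂]
    [AddAction (Fin d → ℤ) Ω₂] [MeasurableConstVAdd (Fin d → ℤ) Ω₂]
    [ErgodicVAdd (Fin d → ℤ) Ω₂ P₂]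
    (τ₁ : (Fin d → ℤ) → FPP.directions d → Ω₁ → ℝ) (hτ₁ : FPP.IsStationary τ₁)
    (τ₂ : (Fin d → ℤ) → FPP.directions d → Ω₂ → ℝ) (hτ₂ : FPP.IsStationary τ₂)
    (a₁ b₁ a₂ b₂ : ℝ) (h₁ : FPP.HasEssBounds P₁ τ₁ a₁ b₁) (h₂ : FPP.HasEssBounds P₂ τ₂ a₂ b₂) :
    ∃ m₁ m₂ : (Fin d → ℝ) → ℝ,
      FPP.IsTimeConstant P₁ τ₁ m₁ ∧ FPP.IsTimeConstant P₂ τ₂ m₂ ∧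
      ∀ x : Fin d → ℝ, |m₁ x - m₂ x| ≤ max (b₁ / a₁) (b₂ / a₂) *
        (FPP.couplingDist (FPP.law P₁ τ₁) (FPP.law P₂ τ₂)).toReal * ∑ i, |x i| := by
  obtain ⟨m₁, hm₁⟩ := FPP.exists_isTimeConstant hτ₁ (h₁.ae_mem.mono fun ω hω x α =>
    ⟨h₁.pos.le.trans (hω x α).1, (hω x α).2⟩)
  obtain ⟨m₂, hm₂⟩ := FPP.exists_isTimeConstant hτ₂ (h₂.ae_mem.mono fun ω hω x α =>
    ⟨h₂.pos.le.trans (hω x α).1, (hω x α).2⟩)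
  refine ⟨m₁, m₂, hm₁, hm₂, fun x => ?_⟩
  have := FPP.isProbabilityMeasure_law (P := P₁) hτ₁.measurable
  have := FPP.isProbabilityMeasure_law (P := P₂) hτ₂.measurable
  have hfin := FPP.couplingDist_ne_top (h₁.ae_law_mem hτ₁.measurable)
    (h₂.ae_law_mem hτ₂.measurable)
  set D := FPP.couplingDist (FPP.law P₁ τ₁) (FPP.law P₂ τ₂) with hD
  -- The infimum over couplings is not known to be attained, so work with `δ` above it and let `δ`
  -- decrease at the end.
  have key : ∀ δ : ℝ, D.toReal < δ →
      |m₁ x - m₂ x| ≤ max (b₁ / a₁) (b₂ / a₂) * δ * ∑ i, |x i| := by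
    intro δ hδ
    have hδ0 : 0 ≤ δ := ENNReal.toReal_nonneg.trans hδ.le
    rw [← ENNReal.lt_ofReal_iff_toReal_lt hfin, hD, FPP.couplingDist] at hδ
    obtain ⟨π, hπ, hlt⟩ := by simpa only [iInf_lt_iff, exists_prop] using hδ
    have hπ1 : IsProbabilityMeasure π := by
      have h : IsProbabilityMeasure (π.map Prod.fst) := by
        rw [hπ.1]
        infer_instance
      exact Measure.isProbabilityMeasure_of_map Prod.fst
    -- A single pair in the intersection of the full-measure events; it exists since `π` is a
    -- probability measure.
    obtain ⟨t, ⟨hb₁, hb₂⟩, ⟨ht₁, ht₂⟩, hdist⟩ :=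
      ((FPP.ae_of_mem_couplings hπ (h₁.ae_law_mem hτ₁.measurable)
        (h₂.ae_law_mem hτ₂.measurable)).and
      ((FPP.ae_of_mem_couplings hπ (hm₁.ae_law_tendsto hτ₁.measurable x)
        (hm₂.ae_law_tendsto hτ₂.measurable x)).and (ae_lt_of_essSup_lt hlt))).exists
    have habs : ∀ y α, |t.1 y α - t.2 y α| ≤ δ := fun y α => by
      have h := (le_iSup₂ (f := fun x α => edist (t.1 x α) (t.2 x α)) y α).trans hdist.le
      rwa [edist_dist, Real.dist_eq, ENNReal.ofReal_le_ofReal_iff hδ0] at h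
    -- Excludes `d = 0`: without edges every real is a lower bound, so none is greatest.
    have hne : Nonempty (FPP.directions d) := by
      by_contra hempty
      rw [not_nonempty_iff] at hempty
      exact absurd (h₁.essInf.2 (fun y α => isEmptyElim α)) (not_le.2 (lt_add_one a₁))
    obtain ⟨α₀⟩ := hne
    have hb₁0 : 0 ≤ b₁ := h₁.pos.le.trans ((hb₁ 0 α₀).1.trans (hb₁ 0 α₀).2)
    have hb₂0 : 0 ≤ b₂ := h₂.pos.le.trans ((hb₂ 0 α₀).1.trans (hb₂ 0 α₀).2)
    have hs : 0 ≤ ∑ i, |x i| := Finset.sum_nonneg fun _ _ => abs_nonneg _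
    have e₁ := FPP.le_of_tendsto_scaledPassageTime h₂.pos hδ0
      (fun y α => h₁.pos.le.trans (hb₁ y α).1) hb₂
      (fun y α => by linarith [(abs_le.1 (habs y α)).2]) hb₂0 ht₁ ht₂
    have e₂ := FPP.le_of_tendsto_scaledPassageTime h₁.pos hδ0
      (fun y α => h₂.pos.le.trans (hb₂ y α).1) hb₁
      (fun y α => by linarith [(abs_le.1 (habs y α)).1]) hb₁0 ht₂ ht₁
    have f₁ : b₂ / a₂ * δ * ∑ i, |x i| ≤ max (b₁ / a₁) (b₂ / a₂) * δ * ∑ i, |x i| := by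
      gcongr
      exact le_max_right _ _
    have f₂ : b₁ / a₁ * δ * ∑ i, |x i| ≤ max (b₁ / a₁) (b₂ / a₂) * δ * ∑ i, |x i| := by
      gcongr
      exact le_max_left _ _
    rw [abs_le]
    constructor <;> linarith
  have hcont : Tendsto (fun δ : ℝ => max (b₁ / a₁) (b₂ / a₂) * δ * ∑ i, |x i|) (𝓝[>] D.toReal)
      (𝓝 (max (b₁ / a₁) (b₂ / a₂) * D.toReal * ∑ i, |x i|)) :=
    (Continuous.tendsto (by fun_prop) _).mono_left nhdsWithin_le_nhds
  exact ge_of_tendsto hcont (eventually_mem_nhdsWithin.mono fun δ hδ => key δ hδ)
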